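/- Let $d>2$ be an integer, let $S=S^{d-1}$ be the unit sphere of $\mathbb R^d$ with surface measure $dS$, and put $c_d=\sqrt{\pi}\,(2\pi)^{-d/2}$. The Herglotz space $\mathcal H$ is the space of all functions on $\mathbb R^d$ of the form $$u(x)=(I\varphi)(x)=c_d\int_{S}\varphi(\xi)\,e^{i x\cdot\xi}\,dS(\xi),\qquad \varphi\in L_2(S),$$ with the Hilbert space structure for which $I:L_2(S)\to\mathcal H$ is unitary. It is a reproducing kernel Hilbert space; let $\kappa_x\in\mathcal H$ denote its reproducing kernel at $x\in\mathbb R^d$, so that $u(x)=\langle u,\kappa_x\rangle$ for all $u\in\mathcal H$. Let $a:\mathbb R^d\to\mathbb C$ belong to $L_{1,\mathrm{comp}}(\mathbb R^d)$, that is, $a$ is integrable and vanishes almost everywhere outside some compact set. Then $$F_a(u,v)=\int_{\mathbb R^d}a(x)\,u(x)\,\overline{v(x)}\,dx,\qquad u,v\in\mathcal H,$$ is a bounded sesquilinear form on $\mathcal H$, and the Toeplitz operator $T_a:\mathcal H\to\mathcal H$ is defined by $(T_au)(x)=F_a(u,\kappa_x)$ for $u\in\mathcal H$, $x\in\mathbb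 R^d$. If $T_a$ has finite rank, then $a(x)=0$ for almost every $x\in\mathbb R^d$. -/

import Mathlib

open MeasureTheory

noncomputable section

namespace Herglotz

/-- Euclidean space `ℝ^d`. -/
abbrev Space (d : ℕ) : Type := EuclideanSpace ℝ (Fin d)

/-- The unit sphere `S^{d-1}` of `ℝ^d`. -/
abbrev Sph (d : ℕ) : Type := Metric.sphere (0 : Space d) 1

/-- The surface measure `dS` of the unit sphere. -/
abbrev surf (d : ℕ) : Measure (Sph d) := (volume : Measure (Space d)).toSphere

/-- The Hilbert space `L₂(S^{d-1})` of complex-valued functions. -/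
abbrev SphereL2 (d : ℕ) : Type := Lp ℂ 2 (surf d)

/-- The normalizing constant `c_d = √π / (2π)^{d/2}`. -/
def normConst (d : ℕ) : ℝ := Real.sqrt Real.pi / (2 * Real.pi) ^ ((d : ℝ) / 2)

/-- The function `(I φ)(x) = c_d ∫_S φ(ξ) e^{i x·ξ} dS(ξ)` on `ℝ^d`. -/
def wave {d : ℕ} (φ : SphereL2 d) (x : Space d) : ℂ :=
  (normConst d : ℂ) *
    ∫ ξ : Sph d, φ ξ * Complex.exp (Complex.I * ((inner ℝ x (ξ : Space d) : ℝ) : ℂ)) ∂(surf d)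

theorem normConst_pos (d : ℕ) : 0 < normConst d := by
  unfold normConst
  positivity

/-- The character `ξ ↦ e^{-i x·ξ}` on the sphere. -/
def sphChar {d : ℕ} (x : Space d) : C(Sph d, ℂ) where
  toFun ξ := Complex.exp (-(Complex.I * ((inner ℝ x (ξ : Space d) : ℝ) : ℂ)))
  continuous_toFun := by fun_prop

theorem norm_sphChar_le {d : ℕ} (x : Space d) : ‖sphChar x‖ ≤ 1 := by
  refine (ContinuousMap.norm_le _ zero_le_one).2 fun ξ => ?_
  have : -(Complex.I * ((inner ℝ x (ξ : Space d) : ℝ) : ℂ))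
      = ((-(inner ℝ x (ξ : Space d) : ℝ) : ℝ) : ℂ) * Complex.I := by push_cast; ring
  simp only [sphChar, ContinuousMap.coe_mk]
  rw [this, Complex.norm_exp_ofReal_mul_I]

theorem continuous_sphChar (d : ℕ) : Continuous (fun x : Space d => sphChar x) := by
  refine ContinuousMap.continuous_of_continuous_uncurry _ ?_
  simp only [sphChar, Function.uncurry_def, ContinuousMap.coe_mk]
  fun_prop

theorem inner_toLp {d : ℕ} (g : C(Sph d, ℂ)) (φ : SphereL2 d) :
    inner ℂ (ContinuousMap.toLp 2 (surf d) ℂ g) φ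
      = ∫ ξ, φ ξ * (starRingEnd ℂ) (g ξ) ∂(surf d) := by
  rw [L2.inner_def]
  refine integral_congr_ae ?_
  filter_upwards [ContinuousMap.coeFn_toLp (p := 2) (𝕜 := ℂ) (surf d) g] with ξ hξ
  rw [hξ]
  rfl

theorem wave_eq_inner {d : ℕ} (φ : SphereL2 d) (x : Space d) :
    wave φ x = (normConst d : ℂ) * inner ℂ (ContinuousMap.toLp 2 (surf d) ℂ (sphChar x)) φ := by
  rw [inner_toLp]
  unfold wave
  congr 2
  ext ξ
  congr 1
  simp only [sphChar, ContinuousMap.coe_mk]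
  rw [← Complex.exp_conj]
  simp

theorem continuous_wave {d : ℕ} (φ : SphereL2 d) : Continuous (wave φ) := by
  have h : wave φ = fun x => (normConst d : ℂ) *
      inner ℂ (ContinuousMap.toLp 2 (surf d) ℂ (sphChar x)) φ := funext (wave_eq_inner φ)
  rw [h]
  have := (ContinuousMap.toLp 2 (surf d) ℂ (E := ℂ)).continuous.comp (continuous_sphChar d)
  exact continuous_const.mul (this.inner continuous_const)

theorem exists_wave_bound (d : ℕ) :
    ∃ C : ℝ, 0 ≤ C ∧ ∀ (φ : SphereL2 d) (x : Space d), ‖wave φ x‖ ≤ C * ‖φ‖ := by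
  refine ⟨normConst d * ‖(ContinuousMap.toLp 2 (surf d) ℂ (E := ℂ))‖,
    mul_nonneg (normConst_pos d).le (ContinuousLinearMap.opNorm_nonneg _), fun φ x => ?_⟩
  rw [wave_eq_inner, norm_mul, Complex.norm_real, Real.norm_of_nonneg (normConst_pos d).le,
    mul_assoc]
  refine mul_le_mul_of_nonneg_left ?_ (normConst_pos d).le
  refine (norm_inner_le_norm _ _).trans (mul_le_mul_of_nonneg_right ?_ (norm_nonneg _))
  refine (ContinuousLinearMap.le_opNorm _ _).trans ?_
  exact mul_le_of_le_one_right (ContinuousLinearMap.opNorm_nonneg _) (norm_sphChar_le x)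

/-- The linear map `I : φ ↦ I φ` from `L₂(S^{d-1})` to functions on `ℝ^d`. -/
def waveMap (d : ℕ) : SphereL2 d →ₗ[ℂ] (Space d → ℂ) where
  toFun := wave
  map_add' φ ψ := by
    ext x
    simp only [wave_eq_inner, inner_add_right, mul_add, Pi.add_apply]
  map_smul' c φ := by
    ext x
    simp only [wave_eq_inner, inner_smul_right, Pi.smul_apply, smul_eq_mul, RingHom.id_apply]
    ring

theorem sphChar_mul {d : ℕ} (x y : Space d) : sphChar x * sphChar y = sphChar (x + y) := by
  ext ξ
  simp only [sphChar, ContinuousMap.mul_apply, ContinuousMap.coe_mk, ← Complex.exp_add,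
    inner_add_left]
  congr 1
  push_cast
  ring

theorem star_sphChar {d : ℕ} (x : Space d) : star (sphChar x) = sphChar (-x) := by
  ext ξ
  simp only [sphChar, ContinuousMap.star_apply, ContinuousMap.coe_mk, inner_neg_left]
  rw [Complex.star_def, ← Complex.exp_conj]
  simp

/-- The trigonometric polynomials on the sphere. -/
def trigPoly (d : ℕ) : StarSubalgebra ℂ C(Sph d, ℂ) where
  carrier := Submodule.span ℂ (Set.range (sphChar (d := d)))
  mul_mem' {f g} hf hg := by
    have h := Submodule.mul_mem_mul hf hg
    rw [Submodule.span_mul_span] at h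
    refine Submodule.span_mono ?_ h
    rintro _ ⟨_, ⟨x, rfl⟩, _, ⟨y, rfl⟩, rfl⟩
    exact ⟨x + y, (sphChar_mul x y).symm⟩
  add_mem' hf hg := Submodule.add_mem _ hf hg
  algebraMap_mem' c := by
    have h0 : algebraMap ℂ C(Sph d, ℂ) c = c • sphChar (0 : Space d) := by
      ext ξ
      simp [sphChar]
    rw [h0]
    exact Submodule.smul_mem _ _ (Submodule.subset_span ⟨0, rfl⟩)
  star_mem' {f} hf := by
    refine Submodule.span_induction (p := fun f _ => star f ∈
      (Submodule.span ℂ (Set.range (sphChar (d := d))) : Set C(Sph d, ℂ))) ?_ ?_ ?_ ?_ hf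
    · rintro _ ⟨x, rfl⟩
      rw [star_sphChar]
      exact Submodule.subset_span ⟨-x, rfl⟩
    · simp
    · intro f g _ _ hf hg
      rw [star_add]
      exact Submodule.add_mem _ hf hg
    · intro c f _ hf
      rw [star_smul]
      exact Submodule.smul_mem _ _ hf

theorem trigPoly_separates (d : ℕ) : (trigPoly d).SeparatesPoints := by
  intro ξ η hne
  by_contra! hcon
  apply hne
  have key : ∀ t : ℝ,
      Complex.exp (-(Complex.I *
        ((t * inner ℝ ((ξ : Space d) - (η : Space d)) (ξ : Space d) : ℝ) : ℂ)))
      = Complex.exp (-(Complex.I *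
        ((t * inner ℝ ((ξ : Space d) - (η : Space d)) (η : Space d) : ℝ) : ℂ))) := by
    intro t
    have := hcon (sphChar (t • ((ξ : Space d) - (η : Space d))))
      ⟨_, Submodule.subset_span ⟨_, rfl⟩, rfl⟩
    simpa [sphChar, inner_smul_left] using this
  set p : ℝ := inner ℝ ((ξ : Space d) - (η : Space d)) (ξ : Space d) with hp
  set q : ℝ := inner ℝ ((ξ : Space d) - (η : Space d)) (η : Space d) with hq
  have hd : ∀ (r : ℝ), HasDerivAt (fun t : ℝ =>
      Complex.exp (-(Complex.I * ((t * r : ℝ) : ℂ)))) (-(Complex.I * r)) 0 := by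
    intro r
    have h1 : HasDerivAt (fun t : ℝ => -(Complex.I * ((t * r : ℝ) : ℂ))) (-(Complex.I * r)) 0 := by
      have h2 : HasDerivAt (fun t : ℝ => ((t * r : ℝ) : ℂ)) ((1 * r : ℝ) : ℂ) 0 :=
        ((hasDerivAt_id (0 : ℝ)).mul_const r).ofReal_comp
      simpa using (h2.const_mul Complex.I).fun_neg
    simpa using h1.cexp
  have hpq : p = q := by
    have h1 := (hd p).unique ((hd q).congr_of_eventuallyEq (Filter.Eventually.of_forall key))
    have h2 := neg_injective h1
    exact_mod_cast mul_left_cancel₀ Complex.I_ne_zero h2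
  have : inner ℝ ((ξ : Space d) - (η : Space d)) ((ξ : Space d) - (η : Space d)) = (0 : ℝ) := by
    rw [inner_sub_right, ← hp, ← hq, hpq, sub_self]
  exact Subtype.ext (sub_eq_zero.1 (inner_self_eq_zero.1 this))

theorem waveMap_injective (d : ℕ) : Function.Injective (waveMap d) := by
  rw [← LinearMap.ker_eq_bot, LinearMap.ker_eq_bot']
  intro φ hφ
  have h0 : ∀ x, inner ℂ (ContinuousMap.toLp 2 (surf d) ℂ (sphChar x)) φ = 0 := by
    intro x
    have h : wave φ x = 0 := congrFun hφ x
    rw [wave_eq_inner] at h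
    exact (mul_eq_zero.1 h).resolve_left (by exact_mod_cast (normConst_pos d).ne')
  have h1 : ∀ g ∈ trigPoly d, inner ℂ (ContinuousMap.toLp 2 (surf d) ℂ g) φ = 0 := by
    intro g hg
    refine Submodule.span_induction (p := fun g _ =>
      inner ℂ (ContinuousMap.toLp 2 (surf d) ℂ g) φ = 0) ?_ ?_ ?_ ?_ hg
    · rintro _ ⟨x, rfl⟩
      exact h0 x
    · simp
    · intro f g _ _ hf hg
      rw [map_add, inner_add_left, hf, hg, add_zero]
    · intro c f _ hf
      rw [map_smul, inner_smul_left, hf, mul_zero]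
  have hcl : IsClosed {g : C(Sph d, ℂ) | inner ℂ (ContinuousMap.toLp 2 (surf d) ℂ g) φ = 0} :=
    isClosed_eq ((ContinuousMap.toLp 2 (surf d) ℂ (E := ℂ)).continuous.inner continuous_const)
      continuous_const
  have h2 : ∀ g : C(Sph d, ℂ), inner ℂ (ContinuousMap.toLp 2 (surf d) ℂ g) φ = 0 := by
    intro g
    have hg : g ∈ (trigPoly d).topologicalClosure := by
      rw [ContinuousMap.starSubalgebra_topologicalClosure_eq_top_of_separatesPoints _
        (trigPoly_separates d)]
      trivial
    exact closure_minimal h1 hcl hg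
  exact (ContinuousMap.toLp_denseRange ℂ ℂ (p := 2) (μ := surf d)
    (by norm_num)).eq_zero_of_inner_right ℂ h2

/-- The Herglotz space `ℋ`: the functions `I φ` on `ℝ^d` with `φ ∈ L₂(S^{d-1})`. -/
def HSpace (d : ℕ) : Type := ↥(LinearMap.range (waveMap d))

instance (d : ℕ) : AddCommGroup (HSpace d) :=
  inferInstanceAs (AddCommGroup ↥(LinearMap.range (waveMap d)))

instance (d : ℕ) : Module ℂ (HSpace d) :=
  inferInstanceAs (Module ℂ ↥(LinearMap.range (waveMap d)))

/-- `I` as a linear bijection of `L₂(S^{d-1})` onto `ℋ`. -/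
def waveEquiv (d : ℕ) : SphereL2 d ≃ₗ[ℂ] HSpace d :=
  LinearEquiv.ofInjective (waveMap d) (waveMap_injective d)

/-- The norm of `ℋ`, transported from `L₂(S^{d-1})`: `‖I φ‖ = ‖φ‖`. -/
instance (d : ℕ) : NormedAddCommGroup (HSpace d) :=
  NormedAddCommGroup.induced (HSpace d) (SphereL2 d) (waveEquiv d).symm.toLinearMap
    (waveEquiv d).symm.injective

/-- The scalar product of `ℋ`, transported from `L₂(S^{d-1})`. -/
instance (d : ℕ) : InnerProductSpace ℂ (HSpace d) where
  norm_smul_le c u := by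
    change ‖(waveEquiv d).symm (c • u)‖ ≤ ‖c‖ * ‖(waveEquiv d).symm u‖
    rw [map_smul]
    exact norm_smul_le _ _
  inner u v := inner ℂ ((waveEquiv d).symm u) ((waveEquiv d).symm v)
  norm_sq_eq_re_inner u := norm_sq_eq_re_inner (𝕜 := ℂ) ((waveEquiv d).symm u)
  conj_inner_symm u v := inner_conj_symm _ _
  add_left u v w := by
    rw [map_add]
    exact inner_add_left _ _ _
  smul_left u v c := by
    rw [map_smul]
    exact inner_smul_left _ _ _

/-- `I` as a unitary operator of `L₂(S^{d-1})` onto `ℋ`. -/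
def waveIso (d : ℕ) : SphereL2 d ≃ₗᵢ[ℂ] HSpace d where
  toLinearEquiv := waveEquiv d
  norm_map' φ := by
    change ‖(waveEquiv d).symm (waveEquiv d φ)‖ = ‖φ‖
    rw [LinearEquiv.symm_apply_apply]

instance (d : ℕ) : CompleteSpace (HSpace d) :=
  (waveIso d).toIsometryEquiv.completeSpace_iff.1 inferInstance

theorem val_eq_wave {d : ℕ} (u : HSpace d) : u.val = wave ((waveIso d).symm u) := by
  conv_lhs => rw [← (waveIso d).apply_symm_apply u]
  rfl

/-- `ℋ` is a reproducing kernel Hilbert space of functions on `ℝ^d`; its elements are coerced to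
the functions that they are. -/
instance (d : ℕ) : RKHS ℂ (HSpace d) (Space d) ℂ where
  coeCLM :=
    { toFun := fun u => u.val
      map_add' := fun _ _ => rfl
      map_smul' := fun _ _ => rfl
      cont := by
        refine continuous_pi fun x => ?_
        have h : (fun u : HSpace d => u.val x) = fun u => (normConst d : ℂ) *
            inner ℂ (ContinuousMap.toLp 2 (surf d) ℂ (sphChar x)) ((waveIso d).symm u) := by
          ext u
          rw [val_eq_wave, wave_eq_inner]
        rw [h]
        exact continuous_const.mul
          (continuous_const.inner (waveIso d).symm.continuous) }
  coeCLM_injective := Subtype.val_injective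

theorem coe_eq_wave {d : ℕ} (u : HSpace d) : (⇑u : Space d → ℂ) = wave ((waveIso d).symm u) :=
  val_eq_wave u

/-- The reproducing kernel function `κ_x ∈ ℋ`, i.e. `u(x) = ⟨u, κ_x⟩` for all `u ∈ ℋ`. -/
def ker {d : ℕ} (x : Space d) : HSpace d := RKHS.kerFun (HSpace d) x 1

/-- A bounded sesquilinear form on `ℋ`, linear in the first and antilinear in the second
argument. -/
abbrev BddForm (d : ℕ) : Type := HSpace d →L[ℂ] HSpace d →L⋆[ℂ] ℂ

theorem form_ker_mem {d : ℕ} (F : BddForm d) (u : HSpace d) :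
    (fun x => F u (ker x)) ∈ LinearMap.range (waveMap d) := by
  let T := ContinuousLinearMap.adjoint (InnerProductSpace.continuousLinearMapOfBilin F.flip)
  have h : ((T u : HSpace d) : Space d → ℂ) = fun x => F u (ker x) := by
    ext x
    have h1 : inner ℂ (ker x) (T u) = (T u : HSpace d) x := by
      simp [ker]
    rw [← h1, ContinuousLinearMap.adjoint_inner_right,
      InnerProductSpace.continuousLinearMapOfBilin_apply]
    rfl
  rw [← h]
  exact (T u).2

/-- The Toeplitz operator `T_F` in `ℋ` of a bounded sesquilinear form `F`:
`(T_F u)(x) = F(u, κ_x)`. -/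
def toeplitz {d : ℕ} (F : BddForm d) : HSpace d →ₗ[ℂ] HSpace d where
  toFun u := ⟨fun x => F u (ker x), form_ker_mem F u⟩
  map_add' u v := Subtype.ext (by ext x; simp; rfl)
  map_smul' c u := Subtype.ext (by ext x; simp; rfl)

theorem exists_bound (d : ℕ) :
    ∃ C : ℝ, 0 ≤ C ∧ ∀ (u : HSpace d) (x : Space d), ‖u x‖ ≤ C * ‖u‖ := by
  obtain ⟨C, hC, h⟩ := exists_wave_bound d
  refine ⟨C, hC, fun u x => ?_⟩
  rw [coe_eq_wave, ← (waveIso d).symm.norm_map u]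
  exact h _ x

theorem continuous_coe {d : ℕ} (u : HSpace d) : Continuous (⇑u : Space d → ℂ) := by
  rw [coe_eq_wave]
  exact continuous_wave _

theorem integrable_form {d : ℕ} {a : Space d → ℂ} (ha : Integrable a volume) (u v : HSpace d) :
    Integrable (fun x => a x * u x * (starRingEnd ℂ) (v x)) volume := by
  obtain ⟨C, _, h⟩ := exists_bound d
  have h1 : Integrable (fun x => (u x * (starRingEnd ℂ) (v x)) * a x) volume := by
    refine ha.bdd_mul (c := C * ‖u‖ * (C * ‖v‖)) ?_ ?_
    · exact ((continuous_coe u).mul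
        (Complex.continuous_conj.comp (continuous_coe v))).aestronglyMeasurable
    · refine Filter.Eventually.of_forall fun x => ?_
      rw [norm_mul, RCLike.norm_conj]
      exact mul_le_mul (h u x) (h v x) (norm_nonneg _) ((norm_nonneg _).trans (h u x))
  refine h1.congr (Filter.Eventually.of_forall fun x => ?_)
  simp only
  ring

theorem form_bound {d : ℕ} {a : Space d → ℂ} (ha : Integrable a volume) :
    ∃ C : ℝ, ∀ u v : HSpace d,
      ‖∫ x, a x * u x * (starRingEnd ℂ) (v x) ∂volume‖ ≤ C * ‖u‖ * ‖v‖ := by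
  obtain ⟨C, hC, h⟩ := exists_bound d
  refine ⟨(∫ x, ‖a x‖) * C * C, fun u v => ?_⟩
  have h1 : ‖∫ x, a x * u x * (starRingEnd ℂ) (v x) ∂volume‖
      ≤ ∫ x, ‖a x‖ * (C * ‖u‖ * (C * ‖v‖)) := by
    refine norm_integral_le_of_norm_le (ha.norm.mul_const _)
      (Filter.Eventually.of_forall fun x => ?_)
    rw [norm_mul, norm_mul, RCLike.norm_conj, mul_assoc]
    exact mul_le_mul_of_nonneg_left (mul_le_mul (h u x) (h v x) (norm_nonneg _)
      ((norm_nonneg _).trans (h u x))) (norm_nonneg _)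
  refine h1.trans (le_of_eq ?_)
  rw [integral_mul_const]
  ring

/-- The bounded sesquilinear form `F_a(u, v) = ∫ a(x) u(x) conj(v(x)) dx` of an integrable
symbol `a`. -/
def symbolForm {d : ℕ} (a : Space d → ℂ) (ha : Integrable a volume) : BddForm d :=
  LinearMap.mkContinuousOfExistsBound₂
    (LinearMap.mk₂'ₛₗ (RingHom.id ℂ) (starRingEnd ℂ)
      (fun u v : HSpace d => ∫ x, a x * u x * (starRingEnd ℂ) (v x) ∂volume)
      (fun u u' v => by
        rw [← integral_add (integrable_form ha u v) (integrable_form ha u' v)]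
        congr 1
        ext x
        simp only [RKHS.coe_add, Pi.add_apply]
        ring)
      (fun c u v => by
        rw [RingHom.id_apply, smul_eq_mul, ← integral_const_mul]
        congr 1
        ext x
        simp only [RKHS.coe_smul, Pi.smul_apply, smul_eq_mul]
        ring)
      (fun u v v' => by
        rw [← integral_add (integrable_form ha u v) (integrable_form ha u v')]
        congr 1
        ext x
        simp only [RKHS.coe_add, Pi.add_apply, map_add]
        ring)
      (fun c u v => by
        rw [smul_eq_mul, ← integral_const_mul]
        congr 1
        ext x
        simp only [RKHS.coe_smul, Pi.smul_apply, smul_eq_mul, map_mul]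
        ring))
    (form_bound ha)

/-- The class `L_{1,comp}(ℝ^d)`: integrable functions vanishing a.e. outside a compact set. -/
structure MemL1Comp {d : ℕ} (a : Space d → ℂ) : Prop where
  integrable : Integrable a volume
  compact : ∃ K : Set (Space d), IsCompact K ∧ ∀ᵐ x, x ∉ K → a x = 0

end Herglotz

end

/-!
Write `â(k) = ∫ a(x) e^{i x·k} dx`. The form `F_a` couples the plane waves `e^{i x·ξ}` and
`e^{i x·η}` by `â(ξ - conj η)`, and if `T_a` has rank less than `n`, all the `n × n` matrices
`(F_a(u_i, v_j))` are singular. This extends from Herglotz functions to all functions in their weak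
closure (`exists_combination_orthogonal`). By the identity theorem, the closure contains the plane
waves with complex wave vectors `p + i q`, where `p ⊥ q` and `‖p‖² = 1 + ‖q‖²`
(`Annihilates.integral_planeWave`).

With opposite imaginary parts `±q` for the two families, the exponential growth cancels in the
products `u_i conj v_j`, and the matrix entries are `â(p_i - p'_j)` at real points. The vectors
`p_i`, `p'_j` range over a sphere orthogonal to `q` whose radius `√(1 + ‖q‖²)` is as large as
desired, and which, for `d ≥ 3`, contains a circle. So the differences `p_i - p'_i = k_i` can be
prescribed, while the `p_i - p'_j`, `i ≠ j`, tend to infinity with `‖q‖`, if the `k_i` have equal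
length and different directions in a plane orthogonal to `q`. By the Riemann–Lebesgue lemma the
singular matrices converge to the diagonal matrix with entries `â(k_i)`, so some `â(k_i)` is zero
(`exists_integral_planeWave_eq_zero`). Since the `k_i` may be taken close to any given `k ≠ 0`, the
continuous function `â` vanishes identically, and so does `a` almost everywhere.
-/

namespace Herglotz

open Filter Topology

variable {d : ℕ}

/-! ### Integration against compactly supported integrable functions -/

theorem MemL1Comp.mul_continuous {G : Space d → ℂ} (hG : MemL1Comp G) {f : Space d → ℂ}
    (hf : Continuous f) : MemL1Comp (fun x => G x * f x) := by
  obtain ⟨K, hK, hGK⟩ := hG.compact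
  obtain ⟨C, hC⟩ := hK.exists_bound_of_continuousOn hf.continuousOn
  refine ⟨?_, K, hK, ?_⟩
  · refine (hG.integrable.norm.const_mul C).mono'
      (hG.integrable.aestronglyMeasurable.mul hf.aestronglyMeasurable) ?_
    filter_upwards [hGK] with x hx
    by_cases hxK : x ∈ K
    · rw [norm_mul, mul_comm]
      exact mul_le_mul_of_nonneg_right (hC x hxK) (norm_nonneg _)
    · simp [hx hxK]
  · filter_upwards [hGK] with x hx hxK
    rw [hx hxK, zero_mul]

theorem MemL1Comp.conj {G : Space d → ℂ} (hG : MemL1Comp G) :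
    MemL1Comp (fun x => (starRingEnd ℂ) (G x)) := by
  obtain ⟨K, hK, hGK⟩ := hG.compact
  refine ⟨?_, K, hK, ?_⟩
  · exact (LinearIsometryEquiv.integrable_comp_iff Complex.conjLIE).2 hG.integrable
  · filter_upwards [hGK] with x hx hxK
    rw [hx hxK, map_zero]

/-- Differentiation under the integral sign: compact support of `G` makes any jointly continuous
kernel with jointly continuous derivative admissible. -/
theorem MemL1Comp.differentiable_integral {G : Space d → ℂ} (hG : MemL1Comp G)
    {f f' : ℂ → Space d → ℂ} (hf : ∀ α, Continuous (f α))
    (hf' : Continuous (Function.uncurry f')) (hd : ∀ α x, HasDerivAt (f · x) (f' α x) α) :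
    Differentiable ℂ (fun α => ∫ x, G x * f α x) := by
  intro α₀
  obtain ⟨K, hK, hGK⟩ := hG.compact
  obtain ⟨C, hC⟩ := ((isCompact_closedBall α₀ 1).prod hK).exists_bound_of_continuousOn
    hf'.continuousOn
  refine (hasDerivAt_integral_of_dominated_loc_of_deriv_le (μ := volume)
    (F := fun α x => G x * f α x) (F' := fun α x => G x * f' α x) (bound := fun x => C * ‖G x‖)
    (Metric.ball_mem_nhds α₀ one_pos)
    (Eventually.of_forall fun α => (hG.mul_continuous (hf α)).integrable.aestronglyMeasurable)
    (hG.mul_continuous (hf α₀)).integrable ?_ ?_ (hG.integrable.norm.const_mul C)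
    ?_).2.differentiableAt
  · exact (hG.mul_continuous (hf'.uncurry_left α₀)).integrable.aestronglyMeasurable
  · filter_upwards [hGK] with x hx α hα
    by_cases hxK : x ∈ K
    · rw [norm_mul, mul_comm]
      exact mul_le_mul_of_nonneg_right
        (hC (α, x) ⟨Metric.ball_subset_closedBall hα, hxK⟩) (norm_nonneg _)
    · simp [hx hxK]
  · exact Eventually.of_forall fun x α _ => (hd α x).const_mul _

/-! ### Functions annihilating the Herglotz space -/

/-- `G` annihilates the Herglotz space under the bilinear pairing `∫ G u`. -/
def Annihilates (G : Space d → ℂ) : Prop :=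
  ∀ φ : SphereL2 d, ∫ x, G x * wave φ x = 0

/-- The complex plane wave `x ↦ e^{i x·(p + i q)}`. It solves the Helmholtz equation when
`p ⊥ q` and `‖p‖² = 1 + ‖q‖²`. -/
noncomputable def planeWave (p q : Space d) (x : Space d) : ℂ :=
  Complex.exp (Complex.I * ((inner ℝ x p : ℝ) : ℂ) - ((inner ℝ x q : ℝ) : ℂ))

theorem continuous_planeWave (p q : Space d) : Continuous (planeWave p q) := by
  unfold planeWave
  fun_prop

/-- Fubini against the density `φ = conj g`, where `g(ξ) = ∫ G(x) e^{i x·ξ} dx`, gives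
`∫ |g|² dS = 0`; as `g` is continuous, it vanishes at every point of the sphere. -/
theorem Annihilates.integral_planeWave_sphere {G : Space d → ℂ} (hG : MemL1Comp G)
    (h : Annihilates G) (ξ : Sph d) : ∫ x, G x * planeWave (ξ : Space d) 0 x = 0 := by
  have hcont : Continuous fun ξ : Sph d => ∫ x, G x * planeWave (ξ : Space d) 0 x := by
    refine continuous_of_dominated (bound := fun x => ‖G x‖) ?_ ?_ hG.integrable.norm ?_
    · exact fun ξ =>
        (hG.mul_continuous (continuous_planeWave _ _)).integrable.aestronglyMeasurable
    · refine fun ξ => Eventually.of_forall fun x => ?_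
      simp [planeWave, Complex.norm_exp]
    · refine Eventually.of_forall fun x => ?_
      unfold planeWave
      fun_prop
  set g : C(Sph d, ℂ) := ⟨_, hcont⟩ with hg
  have hw : ∀ x, wave (ContinuousMap.toLp 2 (surf d) ℂ (star g)) x
      = normConst d * ∫ ξ, star (g ξ) * planeWave (ξ : Space d) 0 x ∂(surf d) := by
    intro x
    unfold wave
    congr 1
    refine integral_congr_ae ?_
    filter_upwards [ContinuousMap.coeFn_toLp (p := 2) (𝕜 := ℂ) (surf d) (star g)] with ξ hξ
    rw [hξ]
    simp [planeWave]
  have h1 := h (ContinuousMap.toLp 2 (surf d) ℂ (star g))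
  have h2 : ∫ x, G x * ∫ ξ, star (g ξ) * planeWave (ξ : Space d) 0 x ∂(surf d) = 0 := by
    have hc : (normConst d : ℂ) ≠ 0 := by exact_mod_cast (normConst_pos d).ne'
    refine (mul_eq_zero.1 ?_).resolve_left hc
    rw [← h1, ← integral_const_mul]
    refine integral_congr_ae (Eventually.of_forall fun x => ?_)
    simp only [hw]
    ring
  have hint : Integrable (Function.uncurry fun (x : Space d) (ξ : Sph d) =>
      G x * (star (g ξ) * planeWave (ξ : Space d) 0 x)) (volume.prod (surf d)) := by
    have hgi : Integrable (fun ξ => star (g ξ)) (surf d) :=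
      (star g).continuous.integrable_of_hasCompactSupport
        (HasCompactSupport.of_compactSpace _)
    have h3 := (hG.integrable.mul_prod hgi).bdd_mul (c := 1)
      (f := fun z : Space d × Sph d => planeWave (z.2 : Space d) 0 z.1)
      (by unfold planeWave; exact Continuous.aestronglyMeasurable (by fun_prop))
      (Eventually.of_forall fun z => by simp [planeWave, Complex.norm_exp])
    refine h3.congr (Eventually.of_forall fun z => ?_)
    simp only [Function.uncurry]
    ring
  have h4 : ∫ ξ, star (g ξ) * g ξ ∂(surf d) = 0 := by
    rw [← h2]
    simp_rw [← integral_const_mul]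
    rw [integral_integral_swap hint]
    congr 1
    ext ξ
    rw [hg, ContinuousMap.coe_mk, ← integral_const_mul]
    congr 1
    ext x
    ring
  have h5 : ∫ ξ, ‖g ξ‖ ^ 2 ∂(surf d) = 0 := by
    have h6 : ∀ ξ, star (g ξ) * g ξ = ((‖g ξ‖ ^ 2 : ℝ) : ℂ) := by
      intro ξ
      rw [Complex.star_def, Complex.conj_mul']
      push_cast
      rfl
    simp_rw [h6] at h4
    rw [integral_complex_ofReal] at h4
    exact_mod_cast h4
  have hgc : Continuous fun ξ => ‖g ξ‖ ^ 2 := g.continuous.norm.pow 2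
  rw [integral_eq_zero_iff_of_nonneg (fun _ => by positivity)
    (hgc.integrable_of_hasCompactSupport (HasCompactSupport.of_compactSpace _))] at h5
  have h7 := congrFun ((hgc.ae_eq_iff_eq (surf d) continuous_const).1 h5) ξ
  exact norm_eq_zero.1 (pow_eq_zero_iff two_ne_zero |>.1 h7)

/-- The identity theorem in `α` for `∫ G(x) e^{i x·(sin α ω + cos α e)} dx`, which vanishes for
real `α`, carries the annihilation over to the complex points of the sphere: there
`sin α ω + cos α e = cosh τ ω + i sinh τ e` for `α = π/2 - iτ`. -/
theorem Annihilates.integral_planeWave {G : Space d → ℂ} (hG : MemL1Comp G)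
    (h : Annihilates G) {p q : Space d} (hpq : inner ℝ p q = 0) (hn : ‖p‖ ^ 2 = 1 + ‖q‖ ^ 2) :
    ∫ x, G x * planeWave p q x = 0 := by
  rcases eq_or_ne q 0 with rfl | hq
  · have hp : ‖p‖ = 1 := by
      have : ‖p‖ ^ 2 = 1 := by simpa using hn
      exact (pow_eq_one_iff_of_nonneg (norm_nonneg p) two_ne_zero).1 this
    exact h.integral_planeWave_sphere hG ⟨p, by simpa using hp⟩
  have hq' : 0 < ‖q‖ := norm_pos_iff.2 hq
  have hp' : 0 < ‖p‖ := by
    by_contra hp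
    have : ‖p‖ = 0 := le_antisymm (not_lt.1 hp) (norm_nonneg _)
    rw [this] at hn
    nlinarith
  set ω : Space d := ‖p‖⁻¹ • p with hω
  set e : Space d := ‖q‖⁻¹ • q with he
  have hωn : ‖ω‖ = 1 := by simp [hω, norm_smul, hp'.ne']
  have hen : ‖e‖ = 1 := by simp [he, norm_smul, hq'.ne']
  have hωe : inner ℝ ω e = 0 := by simp [hω, he, inner_smul_left, inner_smul_right, hpq]
  have hpω : p = ‖p‖ • ω := by simp [hω, smul_smul, hp'.ne']
  have hqe : q = ‖q‖ • e := by simp [he, smul_smul, hq'.ne']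
  clear_value ω e
  let f : ℂ → Space d → ℂ := fun α x => Complex.exp (Complex.I *
    (Complex.sin α * ((inner ℝ x ω : ℝ) : ℂ) + Complex.cos α * ((inner ℝ x e : ℝ) : ℂ)))
  let f' : ℂ → Space d → ℂ := fun α x => f α x * (Complex.I *
    (Complex.cos α * ((inner ℝ x ω : ℝ) : ℂ) + -Complex.sin α * ((inner ℝ x e : ℝ) : ℂ)))
  have hdiff : Differentiable ℂ (fun α => ∫ x, G x * f α x) := by
    refine hG.differentiable_integral (f' := f') (fun α => by fun_prop) ?_ fun α x => ?_
    · simp only [f', f, Function.uncurry_def]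
      fun_prop
    · exact ((((Complex.hasDerivAt_sin α).mul_const _).add
        ((Complex.hasDerivAt_cos α).mul_const _)).const_mul _).cexp
  have hreal : ∀ t : ℝ, ∫ x, G x * f t x = 0 := by
    intro t
    have hnorm : ‖Real.sin t • ω + Real.cos t • e‖ = 1 := by
      have h1 : ‖Real.sin t • ω + Real.cos t • e‖ ^ 2 = 1 := by
        rw [norm_add_sq_real, norm_smul, norm_smul, hωn, hen, inner_smul_left, inner_smul_right,
          hωe]
        simp
      exact (pow_eq_one_iff_of_nonneg (norm_nonneg _) two_ne_zero).1 h1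
    rw [← h.integral_planeWave_sphere hG ⟨_, by simpa using hnorm⟩]
    congr 1
    ext x
    simp [f, planeWave, inner_add_right, inner_smul_right]
  have hfreq : ∃ᶠ z in 𝓝[≠] (0 : ℂ), ∫ x, G x * f z x = 0 := by
    have h1 : Tendsto (fun t : ℝ => (t : ℂ)) (𝓝[≠] 0) (𝓝[≠] 0) := by
      refine tendsto_nhdsWithin_of_tendsto_nhds_of_eventually_within _ ?_ ?_
      · exact (Complex.continuous_ofReal.tendsto' 0 0 (by simp)).mono_left nhdsWithin_le_nhds
      · filter_upwards [self_mem_nhdsWithin] with t ht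
        simpa using ht
    exact h1.frequently (Frequently.of_forall hreal)
  have hzero := hdiff.differentiableOn.analyticOnNhd isOpen_univ
    |>.eqOn_zero_of_preconnected_of_frequently_eq_zero isPreconnected_univ (Set.mem_univ 0) hfreq
  set τ : ℝ := Real.arsinh ‖q‖ with hτ
  have hsinh : Real.sinh τ = ‖q‖ := Real.sinh_arsinh _
  have hcosh : Real.cosh τ = ‖p‖ := by
    rw [hτ, Real.cosh_arsinh, ← hn, Real.sqrt_sq hp'.le]
  have hα := hzero (Set.mem_univ ((Real.pi : ℂ) / 2 - τ * Complex.I))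
  simp only [Pi.zero_apply] at hα
  rw [← hα]
  congr 1
  ext x
  congr 1
  simp only [f, planeWave]
  congr 1
  rw [Complex.sin_pi_div_two_sub, Complex.cos_pi_div_two_sub, Complex.cos_mul_I,
    Complex.sin_mul_I, ← Complex.ofReal_cosh, ← Complex.ofReal_sinh, hsinh, hcosh]
  conv_lhs => rw [hpω, hqe]
  simp only [inner_smul_right, Complex.ofReal_mul]
  linear_combination -(‖q‖ * ((inner ℝ x e : ℝ) : ℂ)) * Complex.I_mul_I

/-! ### Toeplitz operators of finite rank -/

theorem inner_toeplitz (F : BddForm d) (u v : HSpace d) : inner ℂ v (toeplitz F u) = F u v := by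
  have h : toeplitz F u
      = ContinuousLinearMap.adjoint (InnerProductSpace.continuousLinearMapOfBilin F.flip) u := by
    refine RKHS.coeCLM_injective (𝕜 := ℂ) (X := Space d) (V := ℂ) ?_
    funext x
    change F u (ker x) = (ContinuousLinearMap.adjoint
      (InnerProductSpace.continuousLinearMapOfBilin F.flip) u : HSpace d) x
    have h1 : inner ℂ (ker x) (ContinuousLinearMap.adjoint
        (InnerProductSpace.continuousLinearMapOfBilin F.flip) u)
        = (ContinuousLinearMap.adjoint
          (InnerProductSpace.continuousLinearMapOfBilin F.flip) u : HSpace d) x := by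
      simp [ker]
    rw [← h1, ContinuousLinearMap.adjoint_inner_right,
      InnerProductSpace.continuousLinearMapOfBilin_apply]
    rfl
  rw [h, ContinuousLinearMap.adjoint_inner_right,
    InnerProductSpace.continuousLinearMapOfBilin_apply]
  rfl

/-- A continuous function that every compactly supported integrable `G` annihilating the Herglotz
space annihilates as well, that is, one in the weak closure of the Herglotz space for the pairing
`∫ G u`. It need not belong to the Herglotz space. -/
structure IsHerglotzLimit (u : Space d → ℂ) : Prop where
  continuous : Continuous u
  integral_eq_zero : ∀ G : Space d → ℂ, MemL1Comp G → Annihilates G → ∫ x, G x * u x = 0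

theorem isHerglotzLimit_planeWave {p q : Space d} (hpq : inner ℝ p q = 0)
    (hn : ‖p‖ ^ 2 = 1 + ‖q‖ ^ 2) : IsHerglotzLimit (planeWave p q) :=
  ⟨continuous_planeWave p q, fun _ hG h => h.integral_planeWave hG hpq hn⟩

/-- If `T_a` has rank less than `n`, then any `n` functions `u_i` have a nontrivial combination
that is orthogonal, with weight `a`, to all Herglotz functions. The combination is chosen
orthogonal to the range `W` of `T_a`; the functions `v ⊥ W` need no further condition, since
`a conj v` annihilates the Herglotz space and hence each `u_i`. -/
theorem exists_combination_orthogonal {a : Space d → ℂ} (ha : MemL1Comp a)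
    [FiniteDimensional ℂ (LinearMap.range (toeplitz (symbolForm a ha.integrable)))] {n : ℕ}
    (hn : Module.finrank ℂ (LinearMap.range (toeplitz (symbolForm a ha.integrable))) < n)
    (u : Fin n → Space d → ℂ) (hu : ∀ i, IsHerglotzLimit (u i)) :
    ∃ c : Fin n → ℂ, c ≠ 0 ∧ ∀ v, IsHerglotzLimit v →
      ∑ i, c i * ∫ x, a x * u i x * (starRingEnd ℂ) (v x) = 0 := by
  set T := toeplitz (symbolForm a ha.integrable) with hT
  set W := LinearMap.range T with hW
  have hint : ∀ i (v : Space d → ℂ), Continuous v →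
      Integrable (fun x => a x * u i x * (starRingEnd ℂ) (v x)) := fun i v hv =>
    ((ha.mul_continuous (hu i).continuous).mul_continuous
      (Complex.continuous_conj.comp hv)).integrable
  let b := Module.finBasis ℂ W
  let M : Matrix (Fin (Module.finrank ℂ W)) (Fin n) ℂ := fun k i =>
    ∫ x, a x * u i x * (starRingEnd ℂ) ((b k : HSpace d) x)
  obtain ⟨c, hcM, hc⟩ := (Submodule.ne_bot_iff _).1 <|
    LinearMap.ker_ne_bot_of_finrank_lt (f := M.mulVecLin) (by simpa using hn)
  refine ⟨c, hc, fun v hv => ?_⟩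
  let S : Submodule ℂ (HSpace d) :=
    { carrier := {v | ∑ i, c i * ∫ x, a x * u i x * (starRingEnd ℂ) (v x) = 0}
      zero_mem' := by simp
      add_mem' := by
        intro v w hv hw
        simp only [Set.mem_ofPred_eq] at hv hw ⊢
        refine Eq.trans ?_ ((congrArg₂ (· + ·) hv hw).trans (add_zero 0))
        rw [← Finset.sum_add_distrib]
        refine Finset.sum_congr rfl fun i _ => ?_
        rw [← mul_add, ← integral_add (hint i _ (continuous_coe v)) (hint i _ (continuous_coe w))]
        congr 2
        ext x
        simp only [RKHS.coe_add, Pi.add_apply, map_add]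
        ring
      smul_mem' := by
        intro z v hv
        simp only [Set.mem_ofPred_eq] at hv ⊢
        rw [← mul_zero ((starRingEnd ℂ) z), ← hv, Finset.mul_sum]
        refine Finset.sum_congr rfl fun i _ => ?_
        rw [mul_left_comm, ← integral_const_mul ((starRingEnd ℂ) z)]
        congr 2
        ext x
        simp only [RKHS.coe_smul, Pi.smul_apply, smul_eq_mul, map_mul]
        ring }
  have hWS : W ≤ S := by
    have hspan : W = Submodule.span ℂ (Set.range fun k => (b k : HSpace d)) := by
      have h1 := congrArg (Submodule.map W.subtype) b.span_eq
      rw [Submodule.map_span, Submodule.map_top, Submodule.range_subtype, ← Set.range_comp] at h1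
      exact h1.symm
    rw [hspan, Submodule.span_le]
    rintro _ ⟨k, rfl⟩
    have h1 := congrFun (LinearMap.mem_ker.1 hcM) k
    simp only [Matrix.mulVecLin_apply, Matrix.mulVec, dotProduct, Pi.zero_apply] at h1
    change ∑ i, c i * ∫ x, a x * u i x * (starRingEnd ℂ) ((b k : HSpace d) x) = 0
    rw [← h1]
    exact Finset.sum_congr rfl fun i _ => mul_comm _ _
  have hWS' : Wᗮ ≤ S := by
    intro v hv
    have hann : Annihilates fun x => a x * (starRingEnd ℂ) (v x) := by
      intro φ
      have h1 : inner ℂ v (T (waveIso d φ)) = 0 :=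
        Submodule.inner_left_of_mem_orthogonal (LinearMap.mem_range_self T _) hv
      rw [hT, inner_toeplitz] at h1
      have h2 : ∫ x, a x * (waveIso d φ) x * (starRingEnd ℂ) (v x) = 0 := h1
      rw [← h2]
      refine integral_congr_ae (Eventually.of_forall fun x => ?_)
      simp only
      rw [coe_eq_wave (waveIso d φ), LinearIsometryEquiv.symm_apply_apply]
      ring
    change ∑ i, c i * ∫ x, a x * u i x * (starRingEnd ℂ) (v x) = 0
    refine Finset.sum_eq_zero fun i _ => ?_
    rw [← mul_zero (c i), ← (hu i).integral_eq_zero _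
      (ha.mul_continuous (Complex.continuous_conj.comp (continuous_coe v))) hann]
    congr 2
    ext x
    simp only [Function.comp]
    ring
  have hS : S = ⊤ := by
    rw [eq_top_iff, ← Submodule.sup_orthogonal_of_hasOrthogonalProjection (K := W)]
    exact sup_le hWS hWS'
  have hUc : Continuous fun x => ∑ i, c i * u i x :=
    continuous_finsetSum _ fun i _ => continuous_const.mul (hu i).continuous
  have hsum : ∀ v : Space d → ℂ, Continuous v →
      ∑ i, c i * ∫ x, a x * u i x * (starRingEnd ℂ) (v x)
        = (starRingEnd ℂ) (∫ x, (starRingEnd ℂ) (a x * ∑ i, c i * u i x) * v x) := by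
    intro v hv
    rw [← integral_conj]
    simp_rw [← integral_const_mul]
    rw [← integral_finsetSum _ fun i _ => (hint i v hv).const_mul _]
    congr 1
    ext x
    simp only [map_mul, Complex.conj_conj, Finset.mul_sum, Finset.sum_mul]
    exact Finset.sum_congr rfl fun i _ => by ring
  rw [hsum v hv.continuous, hv.integral_eq_zero _ (ha.mul_continuous hUc).conj, map_zero]
  intro φ
  have h1 : waveIso d φ ∈ S := hS ▸ Submodule.mem_top
  have h2 : ∑ i, c i * ∫ x, a x * u i x * (starRingEnd ℂ) (waveIso d φ x) = 0 := h1
  rw [hsum _ (continuous_coe _), map_eq_zero, coe_eq_wave,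
    LinearIsometryEquiv.symm_apply_apply] at h2
  exact h2

/-! ### The Fourier transform of an integrable function -/

theorem planeWave_mul_conj (p p' q x : Space d) :
    planeWave p q x * (starRingEnd ℂ) (planeWave p' (-q) x) = planeWave (p - p') 0 x := by
  unfold planeWave
  rw [← Complex.exp_conj, ← Complex.exp_add]
  congr 1
  simp [inner_sub_right]
  ring

theorem integral_planeWave_eq_fourier (a : Space d → ℂ) (k : Space d) :
    ∫ x, a x * planeWave k 0 x = FourierTransform.fourier a (-(2 * Real.pi)⁻¹ • k) := by
  rw [Real.fourier_eq']
  refine integral_congr_ae (Eventually.of_forall fun x => ?_)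
  have hpi : Real.pi ≠ 0 := Real.pi_ne_zero
  simp only [planeWave, inner_smul_right, inner_zero_right, Complex.ofReal_zero, sub_zero,
    smul_eq_mul]
  rw [mul_comm]
  congr 2
  rw [mul_comm]
  congr 1
  rw [← Complex.ofReal_inj.2 (show (-2 * Real.pi * (-(2 * Real.pi)⁻¹ * inner ℝ x k)) =
    inner ℝ x k by field_simp)]

theorem continuous_integral_planeWave {a : Space d → ℂ} (ha : Integrable a) :
    Continuous fun k : Space d => ∫ x, a x * planeWave k 0 x := by
  refine continuous_of_dominated (bound := fun x => ‖a x‖) (fun k => ?_) (fun k => ?_) ha.norm ?_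
  · exact ha.aestronglyMeasurable.mul (continuous_planeWave k 0).aestronglyMeasurable
  · refine Eventually.of_forall fun x => ?_
    simp [planeWave, Complex.norm_exp]
  · refine Eventually.of_forall fun x => ?_
    unfold planeWave
    fun_prop

/-- The Riemann–Lebesgue lemma along a line. -/
theorem tendsto_integral_planeWave_line (a : Space d → ℂ) (A : Space d) {B : Space d}
    (hB : B ≠ 0) :
    Tendsto (fun s : ℝ => ∫ x, a x * planeWave (A + s • B) 0 x) atTop (𝓝 0) := by
  simp_rw [integral_planeWave_eq_fourier]
  refine (tendsto_integral_exp_inner_smul_cocompact a).comp ?_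
  rw [← Metric.cobounded_eq_cocompact, ← tendsto_norm_atTop_iff_cobounded]
  simp_rw [norm_smul]
  refine Tendsto.const_mul_atTop (by simp [Real.pi_pos.ne']) ?_
  refine tendsto_atTop_mono (f := fun s : ℝ => s * ‖B‖ + -‖A‖) (fun s => ?_)
    (tendsto_atTop_add_const_right _ _ (tendsto_id.atTop_mul_const (norm_pos_iff.2 hB)))
  have h1 := norm_sub_norm_le (s • B) (-A)
  rw [sub_neg_eq_add, norm_neg, norm_smul, Real.norm_eq_abs, add_comm (s • B)] at h1
  nlinarith [le_abs_self s, norm_nonneg B]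

/-- An integrable function whose Fourier transform vanishes is zero almost everywhere: pair it
with the Fourier transform of a Schwartz function, which can be any test function. -/
theorem ae_eq_zero_of_fourier_eq_zero {a : Space d → ℂ} (ha : Integrable a)
    (h : ∀ k, FourierTransform.fourier a k = 0) : a =ᵐ[volume] 0 := by
  refine ae_eq_zero_of_integral_contDiff_smul_eq_zero ha.locallyIntegrable fun g hg hgc => ?_
  have h1 : HasCompactSupport (Complex.ofRealCLM ∘ g) := hgc.comp_left rfl
  have h2 : ContDiff ℝ (⊤ : ℕ∞) (Complex.ofRealCLM ∘ g) := by fun_prop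
  let φ : SchwartzMap (Space d) ℂ := h1.toSchwartzMap h2
  let ψ := FourierTransformInv.fourierInv φ
  have hφ : ∀ x, FourierTransform.fourier (ψ : Space d → ℂ) x = (g x : ℂ) := by
    intro x
    rw [← SchwartzMap.fourier_coe]
    simp only [ψ, FourierTransform.fourier_fourierInv_eq]
    rfl
  have h3 := VectorFourier.integral_fourierIntegral_smul_eq_flip (L := innerₗ (Space d))
    (μ := volume) (ν := volume) (f := a) (g := ψ) Real.continuous_fourierChar
    (by simp only [innerₗ_apply_apply]; fun_prop) ha ψ.integrable
  rw [flip_innerₗ] at h3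
  change ∫ k, FourierTransform.fourier a k • ψ k
    = ∫ x, a x • FourierTransform.fourier (ψ : Space d → ℂ) x at h3
  simp only [h, hφ, zero_smul, integral_zero] at h3
  rw [h3]
  refine integral_congr_ae (Eventually.of_forall fun x => ?_)
  simp [mul_comm]

/-! ### Symbols of finite rank Toeplitz operators -/

/-- The core of the argument. With `u = cos θ e₁ + sin θ e₂`, `w = -sin θ e₁ + cos θ e₂` put
`p = (r/2) u + s w`, `p' = -(r/2) u + s w`; both have norm `√(r²/4 + s²)`, whence the plane waves
with complex wave vectors `p_i + i q` and `p'_j - i q`, where `q = √(r²/4 + s² - 1) e₃`, solve the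
Helmholtz equation, and the form couples them by the Fourier transform of `a` at `p_i - p'_j`. For
`i = j` this point is `r u_i`, and for `i ≠ j` it tends to infinity with `s`. So the singular
coupling matrices converge to a diagonal matrix. -/
theorem exists_integral_planeWave_eq_zero {a : Space d → ℂ} (ha : MemL1Comp a)
    [FiniteDimensional ℂ (LinearMap.range (toeplitz (symbolForm a ha.integrable)))] {n : ℕ}
    (hn : Module.finrank ℂ (LinearMap.range (toeplitz (symbolForm a ha.integrable))) < n)
    {e : Fin 3 → Space d} (he : Orthonormal ℝ e) (r : ℝ) {θ : Fin n → ℝ}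
    (hθ : Function.Injective fun i => Real.sin (θ i)) :
    ∃ i, ∫ x, a x * planeWave (r • (Real.cos (θ i) • e 0 + Real.sin (θ i) • e 1)) 0 x = 0 := by
  have hnorm : ∀ k, inner ℝ (e k) (e k) = 1 := fun k => by
    rw [real_inner_self_eq_norm_sq, he.1 k, one_pow]
  have h01 : inner ℝ (e 0) (e 1) = 0 := he.2 (by decide)
  have h10 : inner ℝ (e 1) (e 0) = 0 := he.2 (by decide)
  have h02 : inner ℝ (e 0) (e 2) = 0 := he.2 (by decide)
  have h12 : inner ℝ (e 1) (e 2) = 0 := he.2 (by decide)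
  let u : Fin n → Space d := fun i => Real.cos (θ i) • e 0 + Real.sin (θ i) • e 1
  let w : Fin n → Space d := fun i => -Real.sin (θ i) • e 0 + Real.cos (θ i) • e 1
  let q : ℝ → Space d := fun s => √(r ^ 2 / 4 + s ^ 2 - 1) • e 2
  -- The sign `t = 1` gives `p`, and `t = -1` gives `p'`.
  let p : ℝ → ℝ → Fin n → Space d := fun t s i => (t * (r / 2)) • u i + s • w i
  have hq : ∀ t s i, inner ℝ (p t s i) (q s) = 0 := by
    intro t s i
    simp [p, q, u, w, inner_add_left, inner_smul_left, inner_smul_right, h02, h12]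
  have hpn : ∀ t s i, t ^ 2 = 1 → 1 ≤ s → ‖p t s i‖ ^ 2 = 1 + ‖q s‖ ^ 2 := by
    intro t s i ht hs
    have h1 : ‖q s‖ ^ 2 = r ^ 2 / 4 + s ^ 2 - 1 := by
      rw [norm_smul, he.1 2, mul_one, Real.norm_eq_abs, sq_abs, Real.sq_sqrt]
      nlinarith [sq_nonneg r]
    rw [h1, ← real_inner_self_eq_norm_sq]
    simp only [p, u, w, inner_add_left, inner_add_right, inner_smul_left, inner_smul_right, h01,
      h10, hnorm, RCLike.conj_to_real]
    linear_combination (r ^ 2 / 4 * t ^ 2 + s ^ 2) * Real.sin_sq_add_cos_sq (θ i) + r ^ 2 / 4 * ht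
  let M : ℝ → Matrix (Fin n) (Fin n) ℂ := fun s i j =>
    ∫ x, a x * planeWave (p 1 s i - p (-1) s j) 0 x
  have hdet : ∀ s, 1 ≤ s → (M s).det = 0 := by
    intro s hs
    obtain ⟨c, hc, h⟩ := exists_combination_orthogonal ha hn (fun i => planeWave (p 1 s i) (q s))
      fun i => isHerglotzLimit_planeWave (hq 1 s i) (hpn 1 s i (by norm_num) hs)
    refine Matrix.exists_vecMul_eq_zero_iff.1 ⟨c, hc, ?_⟩
    funext j
    have h1 := h _ (isHerglotzLimit_planeWave (p := p (-1) s j) (q := -q s)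
      (by rw [inner_neg_right, hq, neg_zero])
      (by rw [norm_neg]; exact hpn (-1) s j (by norm_num) hs))
    simp_rw [mul_assoc, planeWave_mul_conj] at h1
    exact h1
  let D : Matrix (Fin n) (Fin n) ℂ := Matrix.diagonal fun i => ∫ x, a x * planeWave (r • u i) 0 x
  have hlim : Tendsto M atTop (𝓝 D) := by
    refine tendsto_pi_nhds.2 fun i => tendsto_pi_nhds.2 fun j => ?_
    have hpp : ∀ s, p 1 s i - p (-1) s j = (r / 2) • (u i + u j) + s • (w i - w j) := by
      intro s
      simp only [p]
      module
    rcases eq_or_ne i j with rfl | hij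
    · have h1 : (fun s => M s i i) = fun _ => D i i := by
        funext s
        simp only [M, D, Matrix.diagonal_apply_eq, hpp, sub_self, smul_zero, add_zero]
        rw [← two_smul ℝ (u i), smul_smul, div_mul_cancel₀ r two_ne_zero]
      rw [h1]
      exact tendsto_const_nhds
    · simp only [M, D, Matrix.diagonal_apply_ne _ hij, hpp]
      refine tendsto_integral_planeWave_line a _ fun hw => hij (hθ ?_)
      have h1 : inner ℝ (w i - w j) (e 0) = 0 := by rw [hw, inner_zero_left]
      simp only [w, inner_sub_left, inner_add_left, inner_smul_left, hnorm, h10,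
        RCLike.conj_to_real] at h1
      simp only
      linarith
  have hD : D.det = 0 := by
    refine tendsto_nhds_unique
      ((Continuous.matrix_det continuous_id).continuousAt.tendsto.comp hlim) ?_
    refine tendsto_const_nhds.congr' ?_
    filter_upwards [eventually_ge_atTop 1] with s hs
    exact (hdet s hs).symm
  rw [Matrix.det_diagonal, Finset.prod_eq_zero_iff] at hD
  obtain ⟨i, -, hi⟩ := hD
  exact ⟨i, hi⟩

/-- A nonzero value of the Fourier transform of `a` at some `k ≠ 0` persists under small rotations
of `k` in a plane; as `d ≥ 3`, a unit vector orthogonal to that plane is available, and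
`exists_integral_planeWave_eq_zero` applies to sufficiently many of these rotations. -/
theorem ae_eq_zero_of_finiteDimensional_range_toeplitz (hd : 2 < d) {a : Space d → ℂ}
    (ha : MemL1Comp a)
    [FiniteDimensional ℂ (LinearMap.range (toeplitz (symbolForm a ha.integrable)))] :
    a =ᵐ[volume] 0 := by
  have : NeZero d := ⟨by omega⟩
  have hcont := continuous_integral_planeWave ha.integrable
  suffices h : ∀ k, ∫ x, a x * planeWave k 0 x = 0 by
    refine ae_eq_zero_of_fourier_eq_zero ha.integrable fun k => ?_
    rw [← h (-(2 * Real.pi) • k), integral_planeWave_eq_fourier, smul_smul]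
    have hpi : (2 * Real.pi) ≠ 0 := by positivity
    rw [neg_mul_neg, inv_mul_cancel₀ hpi, one_smul]
  suffices h : ∀ k, k ≠ 0 → ∫ x, a x * planeWave k 0 x = 0 by
    exact congrFun (hcont.ext_on (dense_compl_singleton (0 : Space d)) continuous_const
      fun k hk => h k hk)
  intro k hk
  by_contra hak
  obtain ⟨b, hb⟩ := Orthonormal.exists_orthonormalBasis_extension_of_card_eq (𝕜 := ℝ)
    (E := Space d) (ι := Fin d) (by simp) (v := fun _ => ‖k‖⁻¹ • k) (s := {(0 : Fin d)})
    (by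
      refine ⟨fun _ => by simp [norm_smul, hk], fun i j hij => ?_⟩
      exact absurd (Subsingleton.elim i j) hij)
  have hinj : Function.Injective (Fin.castLE (n := 3) (m := d) hd) := Fin.castLE_injective _
  have he : Orthonormal ℝ (b ∘ Fin.castLE (n := 3) (m := d) hd) := b.orthonormal.comp _ hinj
  have hk1 : ‖k‖ • b (Fin.castLE (n := 3) (m := d) hd 0) = k := by
    rw [hb _ (by simp [Fin.ext_iff]), smul_smul, mul_inv_cancel₀ (norm_ne_zero_iff.2 hk), one_smul]
  -- The rotations of `k` by small angles towards the second basis vector.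
  let κ : ℝ → Space d := fun t => ‖k‖ • (Real.cos t • (b ∘ Fin.castLE (n := 3) (m := d) hd) 0 +
    Real.sin t • (b ∘ Fin.castLE (n := 3) (m := d) hd) 1)
  have hκ : Continuous κ := by fun_prop
  have hκ0 : ∫ x, a x * planeWave (κ 0) 0 x ≠ 0 := by
    have : κ 0 = k := by simpa [κ] using hk1
    rwa [this]
  obtain ⟨ε, hε, hball⟩ := Metric.eventually_nhds_iff.1
    ((hcont.comp hκ).continuousAt.eventually_ne hκ0)
  set N := Module.finrank ℂ (LinearMap.range (toeplitz (symbolForm a ha.integrable))) with hN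
  set δ := min ε 1 with hδ
  have hδ0 : 0 < δ := lt_min hε one_pos
  have hfrac : ∀ i : Fin (N + 1), 0 ≤ δ * ((i : ℝ) / (N + 1)) ∧ δ * ((i : ℝ) / (N + 1)) < δ := by
    intro i
    refine ⟨by positivity, mul_lt_of_lt_one_right hδ0 ?_⟩
    rw [div_lt_one (by positivity)]
    exact_mod_cast i.2
  obtain ⟨i, hi⟩ := exists_integral_planeWave_eq_zero ha (n := N + 1) (Nat.lt_succ_self _) he ‖k‖
    (θ := fun i => δ * ((i : ℝ) / (N + 1))) (by
      intro i j hij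
      have hmem : ∀ i : Fin (N + 1),
          δ * ((i : ℝ) / (N + 1)) ∈ Set.Icc (-(Real.pi / 2)) (Real.pi / 2) := by
        intro i
        have := Real.pi_gt_three
        have := min_le_right ε 1
        exact ⟨by linarith [(hfrac i).1], by linarith [(hfrac i).2]⟩
      have h1 := mul_left_cancel₀ hδ0.ne' (Real.injOn_sin (hmem i) (hmem j) hij)
      rw [div_left_inj' (by positivity)] at h1
      exact Fin.ext (by exact_mod_cast h1))
  refine hball (y := δ * ((i : ℝ) / (N + 1))) ?_ hi
  rw [Real.dist_eq, sub_zero, abs_of_nonneg (hfrac i).1]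
  exact (hfrac i).2.trans_le (min_le_left _ _)

end Herglotz

theorem theorem6p3 (d : ℕ) (hd : 2 < d) (a : Herglotz.Space d → ℂ) (ha : Herglotz.MemL1Comp a)
    (hrank : FiniteDimensional ℂ
      (LinearMap.range (Herglotz.toeplitz (Herglotz.symbolForm a ha.integrable)))) :
    a =ᵐ[MeasureTheory.volume] 0 :=
  Herglotz.ae_eq_zero_of_finiteDimensional_range_toeplitz hd ha
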